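/- Let $d\ge 0$, let $\mathcal K$ be a complex Hilbert space and let $\varepsilon>0$. For $r>0$ let $B_{\mathbb C}(0,r)$ be the set of all $d$-tuples $Z=(Z_1,\dots,Z_d)$ of complex $n\times n$ matrices, of any size $n$, with $\max_i\|Z_i\|<r$ (operator norm), and let $B_{\mathbb R}(0,r)$ be the set of the tuples of Hermitian matrices in it. Words in the noncommuting letters $x_1,\dots,x_d$ are denoted $\alpha,\beta,\dots$, the empty word is $1$, $\beta^*$ is the word $\beta$ reversed, and $Z^\alpha$ is the corresponding product of the $Z_i$. Let $c_\alpha\in\mathcal B(\mathcal K)$ be coefficients such that the series $f(Z)=\sum_\alpha c_\alpha\otimes Z^\alpha\in\mathcal B(\mathcal K\otimes\mathbb C^n)$ converges absolutely at each point of $B_{\mathbb C}(0,1+\varepsilon)$ and uniformly on $B_{\mathbb C}(0,1+\varepsilon)$ (partial sums being taken by word length). Assume that $f$ is matrix monotone on $B_{\mathbb R}(0,1+\varepsilon)$: its values there are self-adjoint, and $f(X)\le f(Y)$ whenever $X,Y\in B_{\mathbb R}(0,1+\varepsilon)$ have the same size and $X_i\le Y_i$ for all $i$. Then for each $i=1,\dots,d$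 the localizing matrix $C_i=[c_{\beta^*x_i\alpha}]_{\beta,\alpha}$ is positive semidefinite, so that \[ \langle \alpha\otimes v,\beta\otimes w\rangle_{\mathcal H_i}=w^*c_{\beta^*x_i\alpha}v\qquad(v,w\in\mathcal K) \] defines a Hilbert space $\mathcal H_i$, the Hausdorff completion of the span of the symbols $\alpha\otimes v$. Let $\mathcal H=\bigoplus_i\mathcal H_i$, let $P_i$ be the orthogonal projection of $\mathcal H$ onto $\mathcal H_i$, write $\alpha\otimes v$ also for the vector of $\mathcal H$ whose component in every $\mathcal H_i$ is $\alpha\otimes v$, and let $Q:\mathcal K\to\mathcal H$, $Qk=1\otimes k$. There is exactly one bounded operator $A$ on $\mathcal H$ with \[ A\,P_j(\alpha\otimes v)=x_j\alpha\otimes v\qquad\text{for all } j,\alpha,v . \] It satisfies $A(\alpha\otimes v)=\sum_i x_i\alpha\otimes v$, it is self-adjoint, and $\|A\|\le 1$. Finally, for every $Z\in B_{\mathbb C}(0,1+\varepsilon)$ whose entries $Z_i$ are all invertible, the operator $A-\sum_iP_iZ_i^{-1}$, that is $A\otimes I_n-\sum_iP_i\otimes Z_i^{-1}$ on $\mathcal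 H\otimes\mathbb C^n$, is invertible and \[ f(Z)=a_0-Q^*\Bigl(A-\sum_iP_iZ_i^{-1}\Bigr)^{-1}Q,\qquad a_0=c_1=f(0), \] where $a_0$ and $Q$ stand for $a_0\otimes I_n$ and $Q\otimes I_n$. -/

import Mathlib

noncomputable section

namespace NCRealization

open scoped Matrix.Norms.L2Operator ComplexOrder

/-- Words in the noncommuting letters `x_1, …, x_d`; the empty word is `1`. -/
abbrev Word (d : ℕ) := FreeMonoid (Fin d)

/-- `d`-tuples of complex `n × n` matrices: level `n` of the matrix universe over `ℝ^d`. -/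
abbrev Tuple (d n : ℕ) := Fin d → Matrix (Fin n) (Fin n) ℂ

/-- The Hilbert space `E ⊗ ℂⁿ`, i.e. the Hilbert direct sum of `n` copies of `E`. -/
abbrev Amp (n : ℕ) (E : Type*) := PiLp 2 (fun _ : Fin n => E)

section Tensor

variable {E F : Type*} [NormedAddCommGroup E] [InnerProductSpace ℂ E]
  [NormedAddCommGroup F] [InnerProductSpace ℂ F] {n : ℕ}

/-- The operator `T ⊗ M : E ⊗ ℂⁿ → F ⊗ ℂⁿ`. -/
def tensor (T : E →L[ℂ] F) (M : Matrix (Fin n) (Fin n) ℂ) : Amp n E →L[ℂ] Amp n F :=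
  (PiLp.continuousLinearEquiv 2 ℂ (fun _ : Fin n => F)).symm.toContinuousLinearMap ∘L
    (ContinuousLinearMap.pi fun j => ∑ k, M j k • (T ∘L ContinuousLinearMap.proj k)) ∘L
    (PiLp.continuousLinearEquiv 2 ℂ (fun _ : Fin n => E)).toContinuousLinearMap

lemma tensor_apply (T : E →L[ℂ] F) (M : Matrix (Fin n) (Fin n) ℂ) (x : Amp n E) (j : Fin n) :
    tensor T M x j = ∑ k, M j k • T (x k) := by
  simp [tensor]

end Tensor

/-- Level `n` of the complex ball `B_ℂ(0, r)`: the norm of a tuple, as a matrix over the operator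
system `ℝ^d`, is the largest of the operator norms of its entries. -/
def complexBall (d : ℕ) (r : ℝ) (n : ℕ) : Set (Tuple d n) :=
  {Z | ∀ i, ‖Z i‖ < r}

/-- Level `n` of the real ball `B_ℝ(0, r)`: the Hermitian tuples in the complex ball. -/
def realBall (d : ℕ) (r : ℝ) (n : ℕ) : Set (Tuple d n) :=
  {X | X ∈ complexBall d r n ∧ ∀ i, (X i).IsHermitian}

variable {d : ℕ} {K : Type*} [NormedAddCommGroup K] [InnerProductSpace ℂ K]

/-- On the sets `G n` of Hermitian tuples, `f` takes self-adjoint values and `X ≤ Y` implies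
`f(X) ≤ f(Y)`. Here `X ≤ Y` means that every `Y i - X i` is positive semidefinite. -/
def MatrixMonotoneOn [CompleteSpace K] (G : ∀ n, Set (Tuple d n))
    (f : ∀ n, Tuple d n → (Amp n K →L[ℂ] Amp n K)) : Prop :=
  (∀ n, ∀ X ∈ G n, IsSelfAdjoint (f n X)) ∧
  ∀ n, ∀ X ∈ G n, ∀ Y ∈ G n, (∀ i, (Y i - X i).PosSemidef) → f n X ≤ f n Y

/-- The term `c_α Z^α` of a noncommutative power series with operator coefficients. -/
def seriesTerm (c : Word d → (K →L[ℂ] K)) {n : ℕ} (Z : Tuple d n) (α : Word d) :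
    Amp n K →L[ℂ] Amp n K :=
  tensor (c α) (FreeMonoid.lift Z α)

/-- The sum of the terms `c_α Z^α` over the words `α` of length less than `N`. -/
def partialSum (c : Word d → (K →L[ℂ] K)) (N : ℕ) {n : ℕ} (Z : Tuple d n) :
    Amp n K →L[ℂ] Amp n K :=
  ∑ k ∈ Finset.range N, ∑ w : Fin k → Fin d, seriesTerm c Z (FreeMonoid.ofList (List.ofFn w))

/-- The series `∑ c_α Z^α` converges absolutely at each point of `B_ℂ(0, r)`, and its partial sums
converge to `f`, uniformly over the points of all levels of `B_ℂ(0, r)`. -/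
def HasPowerSeriesOnComplexBall (c : Word d → (K →L[ℂ] K))
    (f : ∀ n, Tuple d n → (Amp n K →L[ℂ] Amp n K)) (r : ℝ) : Prop :=
  (∀ n, ∀ Z ∈ complexBall d r n, Summable fun α => ‖seriesTerm c Z α‖) ∧
  ∀ δ > 0, ∃ N₀ : ℕ, ∀ N ≥ N₀, ∀ n, ∀ Z ∈ complexBall d r n, ‖f n Z - partialSum c N Z‖ < δ

/-- The `x_i`-localizing matrix, with entry `c_{β* x_i α}` at position `(β, α)`. -/
def localizingMatrix (c : Word d → (K →L[ℂ] K)) (i : Fin d) :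
    Matrix (Word d) (Word d) (K →L[ℂ] K) :=
  Matrix.of fun β α => c (β.reverse * FreeMonoid.of i * α)

variable [CompleteSpace K] (c : Word d → (K →L[ℂ] K))
  [∀ i, Fact (localizingMatrix c i).PosSemidef]

/-- The Hilbert space `H_i`: the Hausdorff completion of the span of the symbols `α ⊗ v` in the
semi-inner product given by the `x_i`-localizing matrix. -/
abbrev Hi (i : Fin d) : Type _ := RKHS.OfKernel (localizingMatrix c i)

/-- The vector `α ⊗ v` of `H_i`, as a bounded linear map of `v`. -/
def symi (i : Fin d) (α : Word d) : K →L[ℂ] Hi c i := RKHS.kerFun (Hi c i) α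

/-- `⟨α ⊗ v, β ⊗ w⟩ = w* c_{β* x_i α} v` in `H_i` (Mathlib's inner product is linear in its second
argument). -/
lemma inner_symi (i : Fin d) (α β : Word d) (v w : K) :
    inner ℂ (symi c i β w) (symi c i α v) =
      inner ℂ w (c (β.reverse * FreeMonoid.of i * α) v) := by
  rw [← inner_conj_symm, symi, symi, ← RKHS.kernel_inner, RKHS.OfKernel.kernel_ofKernel,
    inner_conj_symm]
  rfl

lemma dense_span_symi (i : Fin d) :
    (Submodule.span ℂ {x | ∃ α v, symi c i α v = x}).topologicalClosure = ⊤ :=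
  RKHS.kerFun_dense (Hi c i)

/-- The Hilbert space `H = ⊕ H_i`. -/
abbrev H : Type _ := PiLp 2 (fun i : Fin d => Hi c i)

/-- The orthogonal projection `P_i` of `H` onto the summand `H_i`. -/
def P (i : Fin d) : H c →L[ℂ] H c :=
  (PiLp.continuousLinearEquiv 2 ℂ (fun i : Fin d => Hi c i)).symm.toContinuousLinearMap ∘L
    ContinuousLinearMap.single ℂ (fun i : Fin d => Hi c i) i ∘L
    PiLp.proj 2 (𝕜 := ℂ) (fun i : Fin d => Hi c i) i

lemma P_apply (i : Fin d) (x : H c) (j : Fin d) : P c i x j = if j = i then x j else 0 := by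
  by_cases h : j = i
  · subst h; simp [P]
  · simp [P, h]

/-- The vector `α ⊗ v` of `H`, whose component in every `H_i` is the vector `α ⊗ v` of `H_i`. -/
def sym (α : Word d) : K →L[ℂ] H c :=
  (PiLp.continuousLinearEquiv 2 ℂ (fun i : Fin d => Hi c i)).symm.toContinuousLinearMap ∘L
    ContinuousLinearMap.pi fun i => symi c i α

lemma sym_apply (α : Word d) (v : K) (i : Fin d) : sym c α v i = symi c i α v := rfl

lemma inner_sym (α β : Word d) (v w : K) :
    inner ℂ (sym c β w) (sym c α v) =
      ∑ i, inner ℂ w (c (β.reverse * FreeMonoid.of i * α) v) := by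
  simp only [PiLp.inner_apply, sym_apply, inner_symi]

/-- The map `Q` taking `k ∈ K` to `1 ⊗ k ∈ H`. -/
def Q : K →L[ℂ] H c := sym c 1

/-- `A` acts on `H` as the shift: it maps the vector `α ⊗ v` of the summand `H_j`, which is
`P_j (α ⊗ v)`, to the vector `x_j α ⊗ v` of `H`. As these vectors span a dense subspace of `H`, this
determines the bounded operator `A`. -/
def IsShift (A : H c →L[ℂ] H c) : Prop :=
  ∀ (j : Fin d) (α : Word d) (v : K), A (P c j (sym c α v)) = sym c (FreeMonoid.of j * α) v

/-- The operator `A - ∑ P_i Z_i⁻¹` on `H ⊗ ℂⁿ`. -/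
def pencil (A : H c →L[ℂ] H c) {n : ℕ} (Z : Tuple d n) : Amp n (H c) →L[ℂ] Amp n (H c) :=
  tensor A 1 - ∑ i, tensor (P c i) (Z i)⁻¹

end NCRealization

end

/-!
Positivity of the localizing matrices: compare `f` at `s • X` and at `s • X` with `s` times the
vacuum projection added in slot `i`, where `X` is the tuple of field operators `ℓ_j + ℓ_j*` on the
full Fock space truncated to finitely many words. In the `(β, α)` entry of the difference, the
lowest power of `s` is `|β| + 1 + |α|`, with coefficient `c (β* x_i α)`. Weighting the rows and
columns by powers of `s` and letting `s → 0`, monotonicity gives `C_i ≥ 0`.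

The shift `A` is symmetric on the span of the symbols, and convergence of the series at multiples
of the identity tuple bounds its moments `⟪x, A ^ m x⟫` by `O(r ^ (-m))` for every `r < 1 + ε`.
By Cauchy-Schwarz `‖A ^ k x‖` is log-convex in `k`, which upgrades this to `‖A‖ ≤ (1 + ε)⁻¹`.

Finally `A - ∑ P_i Z_i⁻¹ = (A (∑ P_i Z_i) - 1) ∑ P_i Z_i⁻¹` is inverted by a Neumann series, whose
`k`-th term, compressed by `Q`, is the part of `f` of degree `k + 1`.
-/

noncomputable section

namespace NCRealization

open scoped Matrix.Norms.L2Operator ComplexOrder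
open Filter Topology Asymptotics

section Tensor

variable {E F G : Type*} [NormedAddCommGroup E] [InnerProductSpace ℂ E]
  [NormedAddCommGroup F] [InnerProductSpace ℂ F] [NormedAddCommGroup G] [InnerProductSpace ℂ G]
  {n : ℕ}

lemma tensor_add_right (T : E →L[ℂ] F) (M N : Matrix (Fin n) (Fin n) ℂ) :
    tensor T (M + N) = tensor T M + tensor T N := by
  ext x j
  simp [tensor_apply, Finset.sum_add_distrib, add_smul]

lemma tensor_smul_right (a : ℂ) (T : E →L[ℂ] F) (M : Matrix (Fin n) (Fin n) ℂ) :
    tensor T (a • M) = a • tensor T M := by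
  ext x j
  simp [tensor_apply, Finset.smul_sum, mul_smul]

@[simp] lemma tensor_zero_right (T : E →L[ℂ] F) :
    tensor T (0 : Matrix (Fin n) (Fin n) ℂ) = 0 := by
  ext x j
  simp [tensor_apply]

@[simp] lemma tensor_zero_left (M : Matrix (Fin n) (Fin n) ℂ) :
    tensor (0 : E →L[ℂ] F) M = 0 := by
  ext x j
  simp [tensor_apply]

lemma tensor_sum_left {ι : Type*} (s : Finset ι) (T : ι → (E →L[ℂ] F))
    (M : Matrix (Fin n) (Fin n) ℂ) : tensor (∑ i ∈ s, T i) M = ∑ i ∈ s, tensor (T i) M := by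
  ext x j
  simp only [tensor_apply, sum_apply, WithLp.ofLp_sum, Finset.sum_apply, Finset.smul_sum]
  exact Finset.sum_comm

@[simp] lemma tensor_one_one : tensor (1 : E →L[ℂ] E) (1 : Matrix (Fin n) (Fin n) ℂ) = 1 := by
  ext x j
  simp [tensor_apply, Matrix.one_apply]

lemma tensor_comp (S : F →L[ℂ] G) (T : E →L[ℂ] F) (M N : Matrix (Fin n) (Fin n) ℂ) :
    tensor (S ∘L T) (M * N) = tensor S M ∘L tensor T N := by
  ext x j
  simp only [tensor_apply, ContinuousLinearMap.comp_apply, Matrix.mul_apply, map_sum, map_smul,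
    Finset.smul_sum, smul_smul, Finset.sum_smul]
  exact Finset.sum_comm

lemma tensor_mul (S T : E →L[ℂ] E) (M N : Matrix (Fin n) (Fin n) ℂ) :
    tensor (S * T) (M * N) = tensor S M * tensor T N :=
  tensor_comp S T M N

lemma adjoint_tensor [CompleteSpace E] [CompleteSpace F] (T : E →L[ℂ] F)
    (M : Matrix (Fin n) (Fin n) ℂ) : (tensor T M).adjoint = tensor T.adjoint M.conjTranspose := by
  symm
  rw [ContinuousLinearMap.eq_adjoint_iff]
  intro x y
  simp only [PiLp.inner_apply, tensor_apply, sum_inner, inner_sum, inner_smul_left,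
    inner_smul_right, ContinuousLinearMap.adjoint_inner_left, Matrix.conjTranspose_apply,
    RCLike.star_def, RingHomCompTriple.comp_apply, RingHom.id_apply]
  rw [Finset.sum_comm]

lemma norm_tensor_one_right_le (T : E →L[ℂ] F) :
    ‖tensor T (1 : Matrix (Fin n) (Fin n) ℂ)‖ ≤ ‖T‖ := by
  refine ContinuousLinearMap.opNorm_le_bound _ (norm_nonneg T) fun x => ?_
  have hT (j : Fin n) : tensor T (1 : Matrix (Fin n) (Fin n) ℂ) x j = T (x j) := by
    simp [tensor_apply, Matrix.one_apply]
  refine (sq_le_sq₀ (norm_nonneg _) (by positivity)).mp ?_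
  simp only [mul_pow, PiLp.norm_sq_eq_of_L2, hT, Finset.mul_sum]
  gcongr with j
  rw [← mul_pow]
  gcongr
  exact T.le_opNorm _

/-- The star homomorphism `Z ↦ ∑ i, p i ⊗ Z i`, for a complete family of orthogonal projections
`p i`. -/
def projTensorHom {ι : Type*} [Fintype ι] [CompleteSpace E] (n : ℕ)
    {p : ι → (E →L[ℂ] E)} (hp : CompleteOrthogonalIdempotents p)
    (hsa : ∀ i, IsSelfAdjoint (p i)) :
    (ι → Matrix (Fin n) (Fin n) ℂ) →⋆ₐ[ℂ] (Amp n E →L[ℂ] Amp n E) where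
  toAlgHom := AlgHom.ofLinearMap
    { toFun := fun Z => ∑ i, tensor (p i) (Z i)
      map_add' := fun Z W => by simp [tensor_add_right, Finset.sum_add_distrib]
      map_smul' := fun a Z => by simp [tensor_smul_right, Finset.smul_sum] }
    (by simp [← tensor_sum_left, hp.complete])
    (fun Z W => by
      refine Eq.trans ?_ (Finset.sum_mul_sum ..).symm
      refine Finset.sum_congr rfl fun i _ => ?_
      rw [Finset.sum_eq_single i (fun j _ hj => ?_) (by simp), ← tensor_mul, (hp.idem i).eq,
        Pi.mul_apply]
      rw [← tensor_mul, hp.ortho hj.symm, tensor_zero_left])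
  map_star' Z := by
    refine Eq.trans (Finset.sum_congr rfl fun i _ => ?_)
      (map_sum (starAddEquiv (R := Amp n E →L[ℂ] Amp n E)) _ _).symm
    rw [starAddEquiv_apply, ContinuousLinearMap.star_eq_adjoint, adjoint_tensor, (hsa i).adjoint_eq]
    rfl

end Tensor

section Series

variable {d : ℕ} {K : Type*} [NormedAddCommGroup K] [InnerProductSpace ℂ K]
  {c : Word d → (K →L[ℂ] K)} {f : ∀ n, Tuple d n → (Amp n K →L[ℂ] Amp n K)} {R : ℝ}

lemma hasSum_sum_ofFn {M : Type*} [AddCommMonoid M] [TopologicalSpace M] [RegularSpace M]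
    [ContinuousAdd M] {F : Word d → M} {a : M} (h : HasSum F a) :
    HasSum (fun k => ∑ w : Fin k → Fin d, F (FreeMonoid.ofList (List.ofFn w))) a :=
  ((List.equivSigmaTuple.symm.trans FreeMonoid.ofList).hasSum_iff.mpr h).sigma
    fun _ => hasSum_fintype _

lemma lift_smul {S A : Type*} [CommSemiring S] [Semiring A] [Algebra S A] (a : S)
    (Z : Fin d → A) (α : Word d) :
    FreeMonoid.lift (a • Z) α = a ^ α.length • FreeMonoid.lift Z α := by
  induction α using FreeMonoid.recOn with
  | one => simp
  | of_mul x xs h => simp [h, pow_add, smul_smul, mul_comm]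

lemma seriesTerm_smul (a : ℂ) {n : ℕ} (Z : Tuple d n) (α : Word d) :
    seriesTerm c (a • Z) α = a ^ α.length • seriesTerm c Z α := by
  rw [seriesTerm, lift_smul, tensor_smul_right, seriesTerm]

lemma norm_seriesTerm_smul (a : ℂ) {n : ℕ} (Z : Tuple d n) (α : Word d) :
    ‖seriesTerm c (a • Z) α‖ = ‖a‖ ^ α.length * ‖seriesTerm c Z α‖ := by
  have : NormSMulClass ℂ (Amp n K →L[ℂ] Amp n K) :=
    (ContinuousLinearMap.toNormedSpace (𝕜' := ℂ)).toNormSMulClass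
  rw [seriesTerm_smul, norm_smul, norm_pow]

lemma mem_complexBall_iff_norm_lt {r : ℝ} (hr : 0 < r) {n : ℕ} {Z : Tuple d n} :
    Z ∈ complexBall d r n ↔ ‖Z‖ < r :=
  (pi_norm_lt_iff hr).symm

/-- The series `∑ c_α Z^α` converges absolutely to `f` at each point of `B_ℂ(0, R)`, with no
uniformity in the point. -/
structure HasPointwiseSeriesOn (c : Word d → (K →L[ℂ] K))
    (f : ∀ n, Tuple d n → (Amp n K →L[ℂ] Amp n K)) (R : ℝ) : Prop where
  summable_norm : ∀ n, ∀ Z ∈ complexBall d R n, Summable fun α => ‖seriesTerm c Z α‖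
  hasSum : ∀ n, ∀ Z ∈ complexBall d R n, HasSum (seriesTerm c Z) (f n Z)

lemma HasPowerSeriesOnComplexBall.hasPointwiseSeriesOn [CompleteSpace K]
    (h : HasPowerSeriesOnComplexBall c f R) : HasPointwiseSeriesOn c f R where
  summable_norm := h.1
  hasSum n Z hZ := by
    have hsum : Summable (seriesTerm c Z) := (h.1 n Z hZ).of_norm
    have htsum : Tendsto (fun N => partialSum c N Z) atTop (𝓝 (∑' α, seriesTerm c Z α)) :=
      (hasSum_sum_ofFn hsum.hasSum).tendsto_sum_nat
    have hf : Tendsto (fun N => partialSum c N Z) atTop (𝓝 (f n Z)) := by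
      refine Metric.tendsto_atTop.mpr fun δ hδ => ?_
      obtain ⟨N₀, hN₀⟩ := h.2 δ hδ
      exact ⟨N₀, fun N hN => by rw [dist_comm, dist_eq_norm]; exact hN₀ N hN n Z hZ⟩
    rw [← tendsto_nhds_unique htsum hf]
    exact hsum.hasSum

lemma norm_coeff_le_norm_seriesTerm_one {n : ℕ} [NeZero n] (α : Word d) :
    ‖c α‖ ≤ ‖seriesTerm c (1 : Tuple d n) α‖ := by
  have hlift : FreeMonoid.lift (1 : Tuple d n) α = 1 := by
    induction α using FreeMonoid.recOn with
    | one => simp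
    | of_mul x xs h => simp [h]
  refine ContinuousLinearMap.opNorm_le_bound _ (ContinuousLinearMap.opNorm_nonneg _) fun v => ?_
  have hsingle : seriesTerm c (1 : Tuple d n) α (PiLp.single 2 0 v) = PiLp.single 2 0 (c α v) := by
    ext j
    by_cases hj : j = 0 <;> simp [seriesTerm, hlift, tensor_apply, Matrix.one_apply, hj]
  simpa only [hsingle, PiLp.norm_single] using
    (seriesTerm c (1 : Tuple d n) α).le_opNorm (PiLp.single 2 0 v)

lemma HasPointwiseSeriesOn.summable_norm_coeff (h : HasPointwiseSeriesOn c f R)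
    {r : ℝ} (hr : 0 ≤ r) (hrR : r < R) : Summable fun α => ‖c α‖ * r ^ α.length := by
  have hball : (r : ℂ) • (1 : Tuple d 1) ∈ complexBall d R 1 := fun i => by
    simpa [norm_smul, abs_of_nonneg hr] using hrR
  refine (h.summable_norm 1 _ hball).of_nonneg_of_le (fun α => by positivity) fun α => ?_
  rw [norm_seriesTerm_smul, Complex.norm_real, Real.norm_of_nonneg hr, mul_comm]
  gcongr
  exact norm_coeff_le_norm_seriesTerm_one α

end Series

section Fock

variable {d : ℕ} {ι : Type*} {g : ι → Word d}

instance : DecidableEq (Word d) := inferInstanceAs (DecidableEq (List (Fin d)))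

/-- The compression to the words `g a` of the right creation operator `u ↦ u x_j` of the full Fock
space. -/
def creation (g : ι → Word d) (j : Fin d) : Matrix ι ι ℂ :=
  Matrix.of fun a b => if g a = g b * FreeMonoid.of j then 1 else 0

/-- The compression to the words `g a` of the projection of the full Fock space onto its vacuum
vector, the empty word. -/
def vacuum (g : ι → Word d) : Matrix ι ι ℂ :=
  Matrix.of fun a b => if g a = 1 ∧ g b = 1 then 1 else 0

/-- The field operators: each is the sum of a creation operator and its adjoint. -/
def field (g : ι → Word d) (j : Fin d) : Matrix ι ι ℂ :=
  creation g j + (creation g j).conjTranspose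

lemma isHermitian_field (g : ι → Word d) (j : Fin d) : (field g j).IsHermitian :=
  Matrix.isHermitian_add_transpose_self _

lemma posSemidef_vacuum [Finite ι] (g : ι → Word d) : (vacuum g).PosSemidef := by
  have h : vacuum g = Matrix.vecMulVec (fun a => if g a = 1 then 1 else 0)
      (star fun a => if g a = 1 then 1 else 0) := by
    ext a b
    by_cases ha : g a = 1 <;> simp [vacuum, Matrix.vecMulVec_apply, ha]
  exact h ▸ Matrix.posSemidef_vecMulVec_self_star _

lemma of_mul_eq_of_mul_iff {j k : Fin d} {u v : Word d} :
    FreeMonoid.of j * u = FreeMonoid.of k * v ↔ j = k ∧ u = v :=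
  List.cons_eq_cons

lemma mul_of_eq_mul_of_iff {j k : Fin d} {u v : Word d} :
    u * FreeMonoid.of j = v * FreeMonoid.of k ↔ u = v ∧ j = k :=
  List.append_singleton_inj

variable [Fintype ι]

lemma creation_mul_apply_eq_zero {j : Fin d} {N : Matrix ι ι ℂ} {a b : ι}
    (h : ∀ k, g a = g k * FreeMonoid.of j → N k b = 0) : (creation g j * N) a b = 0 := by
  rw [Matrix.mul_apply]
  refine Finset.sum_eq_zero fun k _ => ?_
  by_cases hk : g a = g k * FreeMonoid.of j <;> simp_all [creation]

lemma conjTranspose_creation_mul_apply_eq_zero {j : Fin d} {N : Matrix ι ι ℂ} {a b : ι}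
    (h : ∀ k, g k = g a * FreeMonoid.of j → N k b = 0) :
    ((creation g j).conjTranspose * N) a b = 0 := by
  rw [Matrix.mul_apply]
  refine Finset.sum_eq_zero fun k _ => ?_
  by_cases hk : g k = g a * FreeMonoid.of j <;> simp_all [creation]

lemma creation_mul_apply (hg : g.Injective) {j : Fin d} {a k : ι}
    (hk : g a = g k * FreeMonoid.of j) (N : Matrix ι ι ℂ) (b : ι) :
    (creation g j * N) a b = N k b := by
  classical
  simp [Matrix.mul_apply, creation, hk, hg.eq_iff]

lemma conjTranspose_creation_mul_apply (hg : g.Injective) {j : Fin d} {a k : ι}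
    (hk : g k = g a * FreeMonoid.of j) (N : Matrix ι ι ℂ) (b : ι) :
    ((creation g j).conjTranspose * N) a b = N k b := by
  classical
  simp [Matrix.mul_apply, creation, ← hk, hg.eq_iff]

lemma single_vacuum_mul_apply (hg : g.Injective) (i j : Fin d) (N : Matrix ι ι ℂ) (a b : ι) :
    (Pi.single (M := fun _ => Matrix ι ι ℂ) i (vacuum g) j * N) a b =
      if j = i ∧ g a = 1 then N a b else 0 := by
  classical
  by_cases hj : j = i
  · subst hj
    by_cases ha : g a = 1
    · have hvac (k : ι) : vacuum g a k = if k = a then 1 else 0 := by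
        simp [vacuum, ha, ← hg.eq_iff]
      simp [Matrix.mul_apply, hvac, ha]
    · simp [Matrix.mul_apply, vacuum, ha]
  · simp [hj]

variable [DecidableEq ι]

lemma lift_field_apply (hg : g.Injective) (hprefix : ∀ u v, u * v ∈ Set.range g → u ∈ Set.range g)
    {v : Word d} {a b : ι} (hlen : v.length + (g a).length ≤ (g b).length) :
    FreeMonoid.lift (field g) v a b = if g b = g a * v then 1 else 0 := by
  induction v using FreeMonoid.recOn generalizing a with
  | one => simp [Matrix.one_apply, hg.eq_iff, eq_comm]
  | of_mul j v ih =>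
    simp only [FreeMonoid.length_mul, FreeMonoid.length_of] at hlen
    have hcreation : (creation g j * FreeMonoid.lift (field g) v) a b = 0 := by
      refine creation_mul_apply_eq_zero fun k hk => ?_
      have hlength := congrArg FreeMonoid.length hk
      simp only [FreeMonoid.length_mul, FreeMonoid.length_of] at hlength
      rw [ih (by lia), if_neg (ne_of_apply_ne FreeMonoid.length _)]
      rw [FreeMonoid.length_mul]
      lia
    rw [map_mul, FreeMonoid.lift_eval_of, field, add_mul, Matrix.add_apply, hcreation, zero_add,
      ← mul_assoc]
    by_cases hk : g a * FreeMonoid.of j ∈ Set.range g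
    · obtain ⟨k, hk⟩ := hk
      have hlength := congrArg FreeMonoid.length hk
      simp only [FreeMonoid.length_mul, FreeMonoid.length_of] at hlength
      rw [conjTranspose_creation_mul_apply hg hk, ih (by lia), hk, mul_assoc]
    · rw [conjTranspose_creation_mul_apply_eq_zero fun k h => absurd ⟨k, h⟩ hk, if_neg]
      exact fun h => hk (hprefix _ v ⟨b, h⟩)

lemma lift_add_sub_lift_of_mul {S : Type*} [Ring S] (X B : Fin d → S) (j : Fin d) (v : Word d) :
    FreeMonoid.lift (X + B) (FreeMonoid.of j * v) - FreeMonoid.lift X (FreeMonoid.of j * v) =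
      X j * (FreeMonoid.lift (X + B) v - FreeMonoid.lift X v) +
        B j * FreeMonoid.lift (X + B) v := by
  simp only [map_mul, FreeMonoid.lift_eval_of, Pi.add_apply]
  noncomm_ring

lemma lift_field_add_vacuum_sub_lift_field_of_mul_apply (hg : g.Injective) (i j : Fin d)
    (v : Word d) (a b : ι) :
    (FreeMonoid.lift (field g + Pi.single i (vacuum g)) (FreeMonoid.of j * v) -
      FreeMonoid.lift (field g) (FreeMonoid.of j * v)) a b =
      (creation g j * (FreeMonoid.lift (field g + Pi.single i (vacuum g)) v -
        FreeMonoid.lift (field g) v)) a b +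
      ((creation g j).conjTranspose * (FreeMonoid.lift (field g + Pi.single i (vacuum g)) v -
        FreeMonoid.lift (field g) v)) a b +
      if j = i ∧ g a = 1 then
        (FreeMonoid.lift (field g + Pi.single i (vacuum g)) v : Matrix ι ι ℂ) a b
      else 0 := by
  rw [lift_add_sub_lift_of_mul, Matrix.add_apply, single_vacuum_mul_apply hg, field, add_mul,
    Matrix.add_apply]

lemma lift_field_add_vacuum_sub_lift_field_apply (hg : g.Injective)
    (hprefix : ∀ u v, u * v ∈ Set.range g → u ∈ Set.range g) (i : Fin d) {w : Word d} {a b : ι}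
    (hlen : w.length ≤ (g a).length + (g b).length + 1) :
    (FreeMonoid.lift (field g + Pi.single i (vacuum g)) w - FreeMonoid.lift (field g) w) a b =
      if w = (g a).reverse * FreeMonoid.of i * g b then 1 else 0 := by
  induction w using FreeMonoid.recOn generalizing a with
  | one =>
    rw [if_neg (ne_of_apply_ne FreeMonoid.length _)]
    · simp
    · simp only [FreeMonoid.length_one, FreeMonoid.length_mul, FreeMonoid.length_reverse,
        FreeMonoid.length_of]
      lia
  | of_mul j v ih =>
    rw [lift_field_add_vacuum_sub_lift_field_of_mul_apply hg]
    set Δ := FreeMonoid.lift (field g + Pi.single i (vacuum g)) v - FreeMonoid.lift (field g) v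
    simp only [FreeMonoid.length_mul, FreeMonoid.length_of] at hlen
    have ih_eq_zero {k : ι} (hk : v.length ≤ (g k).length + (g b).length) : Δ k b = 0 := by
      rw [ih (by lia), if_neg (ne_of_apply_ne FreeMonoid.length _)]
      simp only [FreeMonoid.length_mul, FreeMonoid.length_reverse, FreeMonoid.length_of]
      lia
    have hadj : ((creation g j).conjTranspose * Δ) a b = 0 := by
      refine conjTranspose_creation_mul_apply_eq_zero fun k hk => ih_eq_zero ?_
      simp only [hk, FreeMonoid.length_mul, FreeMonoid.length_of]
      lia
    rw [hadj, add_zero]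
    obtain ha | ⟨u, l, ha⟩ : g a = 1 ∨ ∃ (u : Word d) (l : Fin d), g a = u * FreeMonoid.of l :=
      List.eq_nil_or_concat' (g a)
    · rw [ha, FreeMonoid.length_one, zero_add] at hlen
      have hlift := sub_eq_zero.mp (ih_eq_zero (k := a) (by lia))
      rw [creation_mul_apply_eq_zero fun k hk => absurd (ha.symm.trans hk)
          (ne_of_apply_ne FreeMonoid.length (by simp)),
        hlift, lift_field_apply hg hprefix (by rw [ha, FreeMonoid.length_one]; lia)]
      simp [ha, show FreeMonoid.reverse (1 : Word d) = 1 from rfl, of_mul_eq_of_mul_iff, ite_and,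
        eq_comm]
    · obtain ⟨k, rfl⟩ := hprefix u _ ⟨a, ha⟩
      rw [ha, FreeMonoid.length_mul, FreeMonoid.length_of] at hlen
      rw [if_neg fun h => ne_of_apply_ne FreeMonoid.length (by simp) (ha.symm.trans h.2), add_zero]
      simp only [ha, FreeMonoid.reverse_mul, FreeMonoid.reverse_of, mul_assoc,
        of_mul_eq_of_mul_iff]
      by_cases hj : j = l
      · subst hj
        rw [creation_mul_apply hg ha, ih (by lia)]
        simp [mul_assoc]
      · rw [creation_mul_apply_eq_zero, if_neg (by tauto)]
        exact fun k' hk' => absurd (mul_of_eq_mul_of_iff.mp (hk'.symm.trans ha)).2 hj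

lemma exists_word_enumeration (d N : ℕ) : ∃ (n : ℕ) (g : Fin n → Word d), g.Injective ∧
    ∀ w : Word d, w ∈ Set.range g ↔ w.length ≤ N := by
  have hfin : {w : Word d | w.length ≤ N}.Finite := List.finite_length_le (Fin d) N
  have := hfin.to_subtype
  obtain ⟨n, ⟨e⟩⟩ := Finite.exists_equiv_fin {w : Word d | w.length ≤ N}
  refine ⟨n, fun a => e.symm a, Subtype.val_injective.comp e.symm.injective,
    fun w => ⟨?_, fun hw => ⟨e ⟨w, hw⟩, by simp⟩⟩⟩
  rintro ⟨a, rfl⟩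
  exact (e.symm a).2

end Fock

section Entries

variable {E F : Type*} [NormedAddCommGroup E] [NormedAddCommGroup F] {n : ℕ}

lemma sum_single_apply (x : Amp n E) : ∑ a, PiLp.single 2 a (x a) = x := by
  ext j
  simp [Finset.sum_apply, Pi.single_apply]

variable [InnerProductSpace ℂ E] [InnerProductSpace ℂ F]

lemma inner_eq_sum_inner_single (x : Amp n F) (T : Amp n E →L[ℂ] Amp n F) (y : Amp n E) :
    inner ℂ x (T y) =
      ∑ a, ∑ b, inner ℂ (PiLp.single 2 a (x a) : Amp n F) (T (PiLp.single 2 b (y b))) := by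
  conv_lhs => rw [← sum_single_apply x, ← sum_single_apply y]
  simp only [map_sum, sum_inner, inner_sum]
  exact Finset.sum_comm

lemma sum_mul_inner_single_nonneg {T : Amp n E →L[ℂ] Amp n E} (hT : T.IsPositive)
    (t : Fin n → ℝ) (x : Fin n → E) :
    0 ≤ ∑ a, ∑ b, (t a * t b : ℂ) *
      inner ℂ (PiLp.single 2 a (x a) : Amp n E) (T (PiLp.single 2 b (x b))) := by
  refine (hT.inner_nonneg_right (WithLp.toLp 2 fun a => (t a : ℂ) • x a)).trans_eq ?_
  rw [inner_eq_sum_inner_single]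
  have hsingle (z : ℂ) (a : Fin n) (v : E) :
      (PiLp.single 2 a (z • v) : Amp n E) = z • PiLp.single 2 a v := by
    ext j
    simp
  refine Finset.sum_congr rfl fun a _ => Finset.sum_congr rfl fun b _ => ?_
  simp only [hsingle, map_smul, inner_smul_left, inner_smul_right, Complex.conj_ofReal]
  ring

lemma inner_single_tensor_single (T : E →L[ℂ] F) (M : Matrix (Fin n) (Fin n) ℂ) (a b : Fin n)
    (v : F) (w : E) : inner ℂ (PiLp.single 2 a v : Amp n F) (tensor T M (PiLp.single 2 b w)) =
      M a b * inner ℂ v (T w) := by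
  simp only [PiLp.inner_apply, tensor_apply, inner_sum, inner_smul_right]
  rw [Finset.sum_eq_single a, Finset.sum_eq_single b] <;> simp +contextual

end Entries

section Positivity

lemma tendsto_inv_pow_smul_tsum {𝕜 E ι : Type*} [NormedField 𝕜] [NormedAddCommGroup E]
    [NormedSpace 𝕜 E] [CompleteSpace E] {ℓ : ι → ℕ} {u : ι → E} {r : ℝ} (hr : 0 < r)
    (hsum : Summable fun w => r ^ ℓ w * ‖u w‖) {w₀ : ι}
    (hu : ∀ w ≠ w₀, ℓ w ≤ ℓ w₀ → u w = 0) :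
    Tendsto (fun s : 𝕜 => (s ^ ℓ w₀)⁻¹ • ∑' w, s ^ ℓ w • u w) (𝓝[≠] 0) (𝓝 (u w₀)) := by
  classical
  have hterm {s : 𝕜} (hs : s ≠ 0) (w : ι) :
      (s ^ ℓ w₀)⁻¹ • s ^ ℓ w • u w = s ^ (ℓ w - ℓ w₀) • u w := by
    by_cases hw : ℓ w₀ ≤ ℓ w
    · rw [smul_smul, mul_comm, ← pow_sub₀ s hs hw]
    · simp [hu w (by rintro rfl; simp at hw) (by lia)]
  have hlim : Tendsto (fun s : 𝕜 => ∑' w, s ^ (ℓ w - ℓ w₀) • u w) (𝓝[≠] 0)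
      (𝓝 (∑' w, (Pi.single w₀ (u w₀) : ι → E) w)) := by
    refine tendsto_tsum_of_dominated_convergence (hsum.mul_left (r ^ ℓ w₀)⁻¹) (fun w => ?_) ?_
    · refine Tendsto.mono_left ?_ nhdsWithin_le_nhds
      refine Continuous.tendsto' (by fun_prop) _ _ ?_
      rcases eq_or_ne w w₀ with rfl | hw
      · simp
      by_cases hlt : ℓ w ≤ ℓ w₀
      · simp [hu w hw hlt, hw]
      · simp [hw, Nat.sub_ne_zero_of_lt (not_le.mp hlt)]
    · filter_upwards [nhdsWithin_le_nhds (Metric.ball_mem_nhds 0 hr)] with s hs w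
      rw [norm_smul, norm_pow, ← mul_assoc]
      by_cases hw : ℓ w₀ ≤ ℓ w
      · rw [mul_comm _ (r ^ ℓ w), ← pow_sub₀ r hr.ne' hw]
        gcongr
        exact (mem_ball_zero_iff.mp hs).le
      · simp [hu w (by rintro rfl; simp at hw) (by lia)]
  rw [tsum_pi_single] at hlim
  refine hlim.congr' ?_
  filter_upwards [self_mem_nhdsWithin] with s hs
  rw [← tsum_const_smul'' (s ^ ℓ w₀)⁻¹]
  exact tsum_congr fun w => (hterm hs w).symm

variable {d n : ℕ} {K : Type*} [NormedAddCommGroup K] [InnerProductSpace ℂ K]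
  {c : Word d → (K →L[ℂ] K)} {f : ∀ n, Tuple d n → (Amp n K →L[ℂ] Amp n K)} {R : ℝ}

lemma eventually_smul_mem_complexBall {r : ℝ} (hr : 0 < r) (Z : Tuple d n) :
    ∀ᶠ z : ℂ in 𝓝 0, z • Z ∈ complexBall d r n := by
  have htendsto : Tendsto (fun z : ℂ => ‖z • Z‖) (𝓝 0) (𝓝 0) :=
    Continuous.tendsto' (by fun_prop) _ _ (by simp)
  filter_upwards [htendsto.eventually_lt_const hr] with z hz
  exact (mem_complexBall_iff_norm_lt hr).mpr hz

lemma HasPointwiseSeriesOn.hasSum_inner_single (h : HasPointwiseSeriesOn c f R) {Z : Tuple d n}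
    (hZ : Z ∈ complexBall d R n) (a b : Fin n) (v w : K) :
    HasSum (fun α => FreeMonoid.lift Z α a b * inner ℂ v (c α w))
      (inner ℂ (PiLp.single 2 a v : Amp n K) (f n Z (PiLp.single 2 b w))) := by
  have hsum := (h.hasSum n Z hZ).mapL ((innerSL ℂ (PiLp.single 2 a v : Amp n K)) ∘L
    ContinuousLinearMap.apply ℂ (Amp n K) (PiLp.single 2 b w))
  simpa [seriesTerm, inner_single_tensor_single] using hsum

lemma HasPointwiseSeriesOn.tendsto_inv_pow_mul_inner_sub (h : HasPointwiseSeriesOn c f R)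
    (hR : 0 < R) {X Y : Tuple d n} {a b : Fin n} {w₀ : Word d}
    (hXY : ∀ α ≠ w₀, α.length ≤ w₀.length →
      (FreeMonoid.lift Y α - FreeMonoid.lift X α) a b = 0) (v w : K) :
    Tendsto (fun z : ℂ => (z ^ w₀.length)⁻¹ *
        inner ℂ (PiLp.single 2 a v : Amp n K) ((f n (z • Y) - f n (z • X)) (PiLp.single 2 b w)))
      (𝓝[≠] 0)
      (𝓝 ((FreeMonoid.lift Y w₀ - FreeMonoid.lift X w₀) a b * inner ℂ v (c w₀ w))) := by
  set u : Word d → ℂ := fun α =>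
    (FreeMonoid.lift Y α - FreeMonoid.lift X α) a b * inner ℂ v (c α w)
  have hsum {z : ℂ} (hX : z • X ∈ complexBall d R n) (hY : z • Y ∈ complexBall d R n) :
      HasSum (fun α => z ^ α.length • u α)
        (inner ℂ (PiLp.single 2 a v : Amp n K)
          ((f n (z • Y) - f n (z • X)) (PiLp.single 2 b w))) := by
    rw [sub_apply, inner_sub_right]
    refine ((h.hasSum_inner_single hY a b v w).sub
      (h.hasSum_inner_single hX a b v w)).congr_fun fun α => ?_
    simp only [u, lift_smul, Matrix.smul_apply, Matrix.sub_apply, smul_eq_mul]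
    ring
  have hball := (eventually_smul_mem_complexBall hR X).and (eventually_smul_mem_complexBall hR Y)
  obtain ⟨r, hr, hrball⟩ := Metric.eventually_nhds_iff.mp hball
  have hsummable : Summable fun α : Word d => (r / 2) ^ α.length * ‖u α‖ := by
    have hmem := hrball (y := ((r / 2 : ℝ) : ℂ)) (by simpa [abs_of_pos hr] using half_lt_self hr)
    refine (hsum hmem.1 hmem.2).summable.norm.congr fun α => ?_
    simp [abs_of_pos hr]
  have hlim := tendsto_inv_pow_smul_tsum (𝕜 := ℂ) (half_pos hr) hsummable (w₀ := w₀)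
  refine (hlim fun α hα hlen => ?_).congr' ?_
  · simp only [u, hXY α hα hlen, zero_mul]
  · filter_upwards [nhdsWithin_le_nhds hball] with z hz
    rw [(hsum hz.1 hz.2).tsum_eq, smul_eq_mul]

/-- `f` is monotone for the Loewner order on the sets `G n`. Unlike in `MatrixMonotoneOn`, its
values are not required to be self-adjoint. -/
def LoewnerMonotoneOn (G : ∀ n, Set (Tuple d n))
    (f : ∀ n, Tuple d n → (Amp n K →L[ℂ] Amp n K)) : Prop :=
  ∀ n, ∀ X ∈ G n, ∀ Y ∈ G n, (∀ i, (Y i - X i).PosSemidef) → f n X ≤ f n Y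

lemma tendsto_ofReal_nhdsGT_nhdsNE :
    Tendsto (fun s : ℝ => (s : ℂ)) (𝓝[>] 0) (𝓝[≠] 0) :=
  tendsto_nhdsWithin_iff.mpr
    ⟨(Complex.continuous_ofReal.tendsto' 0 0 Complex.ofReal_zero).mono_left nhdsWithin_le_nhds,
      eventually_nhdsWithin_of_forall fun _ hs => Complex.ofReal_ne_zero.mpr (ne_of_gt hs)⟩

lemma LoewnerMonotoneOn.eventually_le {ρ : ℝ} (hmono : LoewnerMonotoneOn (realBall d ρ) f)
    (hρ : 0 < ρ) {X Y : Tuple d n} (hX : ∀ i, (X i).IsHermitian)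
    (hXY : ∀ i, (Y i - X i).PosSemidef) :
    ∀ᶠ s : ℝ in 𝓝[>] 0, f n ((s : ℂ) • X) ≤ f n ((s : ℂ) • Y) := by
  have hofReal := tendsto_ofReal_nhdsGT_nhdsNE.mono_right nhdsWithin_le_nhds
  filter_upwards [hofReal.eventually (eventually_smul_mem_complexBall hρ X),
    hofReal.eventually (eventually_smul_mem_complexBall hρ Y), self_mem_nhdsWithin]
    with s hsX hsY hs
  have hs0 : (0 : ℂ) ≤ s := by exact_mod_cast (Set.mem_Ioi.mp hs).le
  have hY (i : Fin d) : (Y i).IsHermitian := by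
    simpa using (hXY i).isHermitian.add (hX i)
  have hsa : IsSelfAdjoint (s : ℂ) := Complex.conj_ofReal s
  refine hmono n _ ⟨hsX, fun i => (hX i).smul hsa⟩ _ ⟨hsY, fun i => (hY i).smul hsa⟩ fun i => ?_
  simpa [smul_sub] using (hXY i).smul hs0

lemma sum_inner_coeff_nonneg {ρ : ℝ} (hρ : 0 < ρ) (hmono : LoewnerMonotoneOn (realBall d ρ) f)
    (hR : 0 < R) (hseries : HasPointwiseSeriesOn c f R) (i : Fin d) {g : Fin n → Word d}
    (hg : g.Injective) (hprefix : ∀ u v, u * v ∈ Set.range g → u ∈ Set.range g) (x : Fin n → K) :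
    0 ≤ ∑ a, ∑ b, inner ℂ (x a) (c ((g a).reverse * FreeMonoid.of i * g b) (x b)) := by
  set Y : Tuple d n := field g + Pi.single i (vacuum g)
  have hY (j : Fin d) : (Y j - field g j).PosSemidef := by
    by_cases hj : j = i
    · subst hj; simpa [Y] using posSemidef_vacuum g
    · simpa [Y, hj] using Matrix.PosSemidef.zero
  have hlen (a b : Fin n) : ((g a).reverse * FreeMonoid.of i * g b).length =
      (g a).length + (g b).length + 1 := by
    simp only [FreeMonoid.length_mul, FreeMonoid.length_reverse, FreeMonoid.length_of]
    lia
  have hentry (a b : Fin n) := hseries.tendsto_inv_pow_mul_inner_sub hR (X := field g) (Y := Y)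
    (a := a) (b := b) (w₀ := (g a).reverse * FreeMonoid.of i * g b) (fun α hα hα_len => by
      rw [lift_field_add_vacuum_sub_lift_field_apply hg hprefix i
        (hα_len.trans_eq (hlen a b)), if_neg hα]) (x a) (x b)
  have hlim := tendsto_finsetSum Finset.univ fun a _ =>
    tendsto_finsetSum Finset.univ fun b _ => hentry a b
  have hvalue (a b : Fin n) : (FreeMonoid.lift Y ((g a).reverse * FreeMonoid.of i * g b) -
      FreeMonoid.lift (field g) ((g a).reverse * FreeMonoid.of i * g b)) a b = 1 := by
    rw [lift_field_add_vacuum_sub_lift_field_apply hg hprefix i (hlen a b).le, if_pos rfl]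
  simp only [hvalue, one_mul] at hlim
  refine ge_of_tendsto (hlim.comp tendsto_ofReal_nhdsGT_nhdsNE) ?_
  filter_upwards [hmono.eventually_le hρ (isHermitian_field g) hY, self_mem_nhdsWithin]
    with s hle hs
  have hs' : (0 : ℂ) ≤ (s : ℂ)⁻¹ := inv_nonneg.mpr (by exact_mod_cast (Set.mem_Ioi.mp hs).le)
  -- The weights `s ^ (-|g a|)` and `s ^ (-|g b|)` with one more `s⁻¹` make up `s ^ (-|w₀|)`,
  -- where `w₀` is the word of the `(a, b)` entry, since `|w₀| = |g a| + 1 + |g b|`.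
  refine (mul_nonneg hs' (sum_mul_inner_single_nonneg (ContinuousLinearMap.le_def _ _ |>.mp hle)
    (fun a => (s ^ (g a).length)⁻¹) x)).trans_eq ?_
  simp only [Function.comp_apply, Finset.mul_sum]
  refine Finset.sum_congr rfl fun a _ => Finset.sum_congr rfl fun b _ => ?_
  simp only [FreeMonoid.length_mul, FreeMonoid.length_reverse, FreeMonoid.length_of, pow_add,
    Complex.ofReal_inv, Complex.ofReal_pow, mul_inv, pow_one]
  ring

lemma inner_apply_eq_apply_inner_of_sum_inner_nonneg {X : Type*} {M : Matrix X X (K →L[ℂ] K)}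
    (hM : ∀ x : X →₀ K, 0 ≤ x.sum fun β v => x.sum fun α w => inner ℂ v (M β α w))
    (α β : X) (v w : K) : inner ℂ v (M β α w) = inner ℂ (M α β v) w := by
  have him (w : K) : (inner ℂ v (M β α w)).im + (inner ℂ w (M α β v)).im = 0 := by
    have hsum := hM (Finsupp.single β v + Finsupp.single α w)
    have hβ := hM (Finsupp.single β v)
    have hα := hM (Finsupp.single α w)
    simp only [map_zero, inner_zero_right, implies_true, map_add, inner_add_right,
      Finsupp.sum_add_index', Finsupp.sum_single_index, Finsupp.sum_add, inner_zero_left,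
      inner_add_left, Complex.le_def, Complex.zero_re, Complex.add_re, Complex.zero_im,
      Complex.add_im] at hsum hβ hα
    linarith
  have hre : (inner ℂ v (M β α w)).re - (inner ℂ w (M α β v)).re = 0 := by
    simpa [sub_eq_add_neg] using him (Complex.I • w)
  rw [← inner_conj_symm (M α β v)]
  refine Complex.ext ?_ ?_
  · simpa only [Complex.conj_re] using sub_eq_zero.mp hre
  · simpa only [Complex.conj_im] using eq_neg_of_add_eq_zero_left (him w)

lemma posSemidef_of_sum_inner_nonneg [CompleteSpace K] {X : Type*} {M : Matrix X X (K →L[ℂ] K)}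
    (hM : ∀ x : X →₀ K, 0 ≤ x.sum fun β v => x.sum fun α w => inner ℂ v (M β α w)) :
    M.PosSemidef := by
  have hsymm := inner_apply_eq_apply_inner_of_sum_inner_nonneg hM
  have hiff := (RKHS.posSemidef_tfae (𝕜 := ℂ) (K := M)).out 0 2
  refine hiff.mpr ⟨?_, fun x => ?_⟩
  · ext β α w
    refine ext_inner_left ℂ fun v => ?_
    rw [Matrix.conjTranspose_apply, ContinuousLinearMap.star_eq_adjoint,
      ContinuousLinearMap.adjoint_inner_right, hsymm]
  · simpa only [hsymm, Complex.zero_re, RCLike.re_to_complex] using (Complex.le_def.mp (hM x)).1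

lemma posSemidef_localizingMatrix [CompleteSpace K] {ρ : ℝ} (hρ : 0 < ρ)
    (hmono : LoewnerMonotoneOn (realBall d ρ) f) (hR : 0 < R)
    (hseries : HasPointwiseSeriesOn c f R) (i : Fin d) : (localizingMatrix c i).PosSemidef := by
  refine posSemidef_of_sum_inner_nonneg fun x => ?_
  obtain ⟨n, g, hg, hrange⟩ := exists_word_enumeration d (x.support.sup FreeMonoid.length)
  have hprefix (u v : Word d) (h : u * v ∈ Set.range g) : u ∈ Set.range g := by
    rw [hrange, FreeMonoid.length_mul] at h
    exact (hrange u).mpr (by lia)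
  have hsupp : x.support ⊆ Finset.univ.map ⟨g, hg⟩ := fun w hw => by
    simpa using (hrange w).mpr (Finset.le_sup hw)
  have hsum (F : Word d → K → ℂ) (hF : ∀ α, F α 0 = 0) : x.sum F = ∑ a, F (g a) (x (g a)) := by
    rw [Finsupp.sum_of_support_subset x hsupp F fun w _ => hF w, Finset.sum_map]
    rfl
  refine (sum_inner_coeff_nonneg hρ hmono hR hseries i hg hprefix (x ∘ g)).trans_eq ?_
  rw [hsum _ (by simp)]
  refine Finset.sum_congr rfl fun a _ => ?_
  rw [hsum _ (by simp)]
  rfl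

end Positivity

section Growth

lemma le_mul_of_sq_le_of_isBigO_pow {u : ℕ → ℝ} (hu : ∀ k, 0 ≤ u k)
    (hconv : ∀ k, u (k + 1) ^ 2 ≤ u k * u (k + 2)) {ρ : ℝ} (hρ : 0 ≤ ρ)
    (hgrowth : u =O[atTop] (ρ ^ ·)) : u 1 ≤ ρ * u 0 := by
  by_contra! hlt
  have hu₀ : 0 < u 0 := by
    refine (hu 0).lt_of_ne fun h => ?_
    have hsq : u 1 ^ 2 ≤ 0 := by simpa [← h] using hconv 0
    rw [← h, mul_zero] at hlt
    exact (pow_pos hlt 2).not_ge hsq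
  set q := u 1 / u 0 with hq
  have hρq : ρ < q := by rwa [hq, lt_div_iff₀ hu₀]
  have hratio (k : ℕ) : 0 < u k ∧ q * u k ≤ u (k + 1) := by
    induction k with
    | zero => exact ⟨hu₀, by rw [hq, div_mul_cancel₀ _ hu₀.ne']⟩
    | succ k ih =>
      have hpos : 0 < u (k + 1) := (mul_pos (hρ.trans_lt hρq) ih.1).trans_le ih.2
      refine ⟨hpos, le_of_mul_le_mul_left ?_ ih.1⟩
      calc u k * (q * u (k + 1)) = q * u k * u (k + 1) := by ring
        _ ≤ u (k + 1) * u (k + 1) := by gcongr; exact ih.2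
        _ ≤ u k * u (k + 2) := by rw [← sq]; exact hconv k
  have hpow (k : ℕ) : u 0 * q ^ k ≤ u k := by
    induction k with
    | zero => simp
    | succ k ih =>
      calc u 0 * q ^ (k + 1) = q * (u 0 * q ^ k) := by ring
        _ ≤ q * u k := by gcongr; exact (hρ.trans_lt hρq).le
        _ ≤ u (k + 1) := (hratio k).2
  have hq_le : (q ^ · : ℕ → ℝ) =O[atTop] u := by
    refine (isBigO_const_mul_left_iff hu₀.ne').mp (IsBigO.of_norm_le fun k => ?_)
    rw [Real.norm_of_nonneg (mul_nonneg hu₀.le (pow_nonneg (hρ.trans hρq.le) k))]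
    exact hpow k
  refine isLittleO_irrefl (Frequently.of_forall fun k => ?_)
    ((hq_le.trans hgrowth).trans_isLittleO (isLittleO_pow_pow_of_lt_left hρ hρq))
  exact (pow_pos (hρ.trans_lt hρq) k).ne'

variable {𝕜 E V : Type*} [RCLike 𝕜] [AddCommGroup E] [Module 𝕜 E] [NormedAddCommGroup V]
  [InnerProductSpace 𝕜 V] {φ : E →ₗ[𝕜] V} {T : E →ₗ[𝕜] E}

lemma inner_pow_apply_left
    (hT : ∀ x y, inner 𝕜 (φ (T x)) (φ y) = inner 𝕜 (φ x) (φ (T y))) (m : ℕ) (x y : E) :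
    inner 𝕜 (φ ((T ^ m) x)) (φ y) = inner 𝕜 (φ x) (φ ((T ^ m) y)) := by
  induction m generalizing x with
  | zero => simp
  | succ m ih =>
    rw [pow_succ, Module.End.mul_apply, ih, hT, ← Module.End.mul_apply, ← pow_succ', ← pow_succ]

/-- `T` need not be bounded a priori: the growth rate of its moments at `x` controls `T x` because
the norms `‖φ (T ^ k x)‖` form a log-convex sequence. -/
lemma norm_apply_le_of_isBigO_moments
    (hT : ∀ x y, inner 𝕜 (φ (T x)) (φ y) = inner 𝕜 (φ x) (φ (T y))) {ρ : ℝ} (hρ : 0 ≤ ρ) {x : E}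
    (hx : (fun m => inner 𝕜 (φ x) (φ ((T ^ m) x))) =O[atTop] (ρ ^ ·)) :
    ‖φ (T x)‖ ≤ ρ * ‖φ x‖ := by
  have hgrowth : (fun k => ‖φ ((T ^ k) x)‖) =O[atTop] (ρ ^ ·) := by
    refine IsBigO.of_pow two_ne_zero ?_
    have hdouble := hx.comp_tendsto (tendsto_id.const_mul_atTop' two_pos)
    refine hdouble.norm_left.congr (fun k => ?_) fun k => ?_
    · rw [Function.comp_apply, two_mul, id_eq, pow_add, Module.End.mul_apply,
        ← inner_pow_apply_left hT, inner_self_eq_norm_sq_to_K, norm_pow, RCLike.norm_ofReal,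
        abs_norm, Pi.pow_apply]
    · simp only [Function.comp_apply, id_eq, Pi.pow_apply, ← pow_mul, mul_comm]
  have hconv (k : ℕ) : ‖φ ((T ^ (k + 1)) x)‖ ^ 2 ≤ ‖φ ((T ^ k) x)‖ * ‖φ ((T ^ (k + 2)) x)‖ := by
    calc ‖φ ((T ^ (k + 1)) x)‖ ^ 2
        = RCLike.re (inner 𝕜 (φ (T ((T ^ k) x))) (φ ((T ^ (k + 1)) x))) := by
          rw [← Module.End.mul_apply, ← pow_succ', inner_self_eq_norm_sq]
      _ = RCLike.re (inner 𝕜 (φ ((T ^ k) x)) (φ ((T ^ (k + 2)) x))) := by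
          rw [hT, ← Module.End.mul_apply, ← pow_succ']
      _ ≤ ‖φ ((T ^ k) x)‖ * ‖φ ((T ^ (k + 2)) x)‖ := re_inner_le_norm _ _
  simpa using le_mul_of_sq_le_of_isBigO_pow (fun k => norm_nonneg _) hconv hρ hgrowth

end Growth

section SymbolSpace

variable {d : ℕ} {K : Type*} [NormedAddCommGroup K] [InnerProductSpace ℂ K]
  {c : Word d → (K →L[ℂ] K)}

lemma sum_ofFn_succ {M : Type*} [AddCommMonoid M] (F : Word d → M) (m : ℕ) :
    ∑ w : Fin (m + 1) → Fin d, F (FreeMonoid.ofList (List.ofFn w)) =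
      ∑ i, ∑ w : Fin m → Fin d, F (FreeMonoid.of i * FreeMonoid.ofList (List.ofFn w)) := by
  rw [← (Fin.consEquiv fun _ => Fin d).sum_comp, Fintype.sum_prod_type]
  refine Finset.sum_congr rfl fun i _ => Finset.sum_congr rfl fun w _ => ?_
  congr 1
  rw [List.ofFn_succ]
  rfl

lemma isBigO_sum_norm_coeff {r : ℝ} (hr : 0 < r) (hc : Summable fun α => ‖c α‖ * r ^ α.length)
    (γ μ : Word d) :
    (fun m => ∑ w : Fin m → Fin d, ‖c (γ * FreeMonoid.ofList (List.ofFn w) * μ)‖)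
      =O[atTop] (r⁻¹ ^ ·) := by
  have hinj : Function.Injective fun α : Word d => γ * α * μ :=
    (mul_left_injective μ).comp (mul_right_injective γ)
  have hbdd := (hasSum_sum_ofFn (hc.comp_injective hinj).hasSum).summable.tendsto_atTop_zero
    |>.isBigO_one ℝ
  refine (hbdd.mul (isBigO_const_mul_self (r ^ (γ.length + μ.length))⁻¹ (r⁻¹ ^ · : ℕ → ℝ)
    atTop)).congr (fun m => ?_) fun m => one_mul _
  rw [Finset.sum_mul]
  refine Finset.sum_congr rfl fun w _ => ?_
  have hlen : (FreeMonoid.ofList (List.ofFn w)).length = m := by simp [FreeMonoid.length]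
  simp only [Function.comp_apply, FreeMonoid.length_mul, hlen, inv_pow]
  field_simp
  ring

/-- Formal finite linear combinations of the symbols `P_j (α ⊗ v)`. -/
abbrev SymbolSpace (d : ℕ) (K : Type*) [NormedAddCommGroup K] := (Fin d × Word d) →₀ K

/-- The shift `P_j (α ⊗ v) ↦ x_j α ⊗ v = ∑ i, P_i (x_j α ⊗ v)` on formal combinations. -/
def symbolShift (d : ℕ) (K : Type*) [NormedAddCommGroup K] [InnerProductSpace ℂ K] :
    SymbolSpace d K →ₗ[ℂ] SymbolSpace d K :=
  Finsupp.lsum ℂ fun p => ∑ i, Finsupp.lsingle (i, FreeMonoid.of p.1 * p.2)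

lemma symbolShift_single (j : Fin d) (α : Word d) (v : K) :
    symbolShift d K (Finsupp.single (j, α) v) =
      ∑ i, Finsupp.single (i, FreeMonoid.of j * α) v := by
  simp [symbolShift]

end SymbolSpace

section Shift

variable {d : ℕ} {K : Type*} [NormedAddCommGroup K] [InnerProductSpace ℂ K] [CompleteSpace K]
  (c : Word d → (K →L[ℂ] K)) [∀ i, Fact (localizingMatrix c i).PosSemidef]

lemma completeOrthogonalIdempotents_P : CompleteOrthogonalIdempotents (P c) where
  idem i := by
    ext x k : 2
    rw [mul_apply_eq_comp, P_apply, P_apply, ite_eq_left_iff]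
    exact fun h => (if_neg h).symm
  ortho i j hij := by
    ext x k : 2
    simp +contextual [mul_apply_eq_comp, P_apply, hij]
  complete := by
    ext x k
    simp [P_apply]

lemma inner_P_left (i : Fin d) (x y : H c) : inner ℂ (P c i x) y = inner ℂ (x i) (y i) := by
  rw [PiLp.inner_apply, Finset.sum_eq_single i]
  · simp [P_apply]
  · intro j _ hj
    simp [P_apply, hj]
  · simp

lemma inner_P_right (i : Fin d) (x y : H c) : inner ℂ x (P c i y) = inner ℂ (x i) (y i) := by
  rw [← inner_conj_symm, inner_P_left, inner_conj_symm]

lemma isSelfAdjoint_P (i : Fin d) : IsSelfAdjoint (P c i) := by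
  refine ContinuousLinearMap.isSelfAdjoint_iff_isSymmetric.mpr fun x y => ?_
  exact (inner_P_left c i x y).trans (inner_P_right c i x y).symm

lemma inner_P_sym (j : Fin d) (α β : Word d) (v w : K) :
    inner ℂ (P c j (sym c β w)) (sym c α v) =
      inner ℂ w (c (β.reverse * FreeMonoid.of j * α) v) := by
  rw [inner_P_left, sym_apply, sym_apply, inner_symi]

lemma inner_sym_P (j : Fin d) (α β : Word d) (v w : K) :
    inner ℂ (sym c β w) (P c j (sym c α v)) =
      inner ℂ w (c (β.reverse * FreeMonoid.of j * α) v) := by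
  rw [inner_P_right, sym_apply, sym_apply, inner_symi]

/-- The map from formal combinations of symbols to the Hilbert space `H`. -/
def symbolMap : SymbolSpace d K →ₗ[ℂ] H c :=
  Finsupp.lsum ℂ fun p => (P c p.1 ∘L sym c p.2).toLinearMap

lemma symbolMap_single (j : Fin d) (α : Word d) (v : K) :
    symbolMap c (Finsupp.single (j, α) v) = P c j (sym c α v) := by
  simp [symbolMap]

lemma symbolMap_symbolShift_single (j : Fin d) (α : Word d) (v : K) :
    symbolMap c (symbolShift d K (Finsupp.single (j, α) v)) = sym c (FreeMonoid.of j * α) v := by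
  simp only [symbolShift_single, map_sum, symbolMap_single]
  rw [← sum_apply, (completeOrthogonalIdempotents_P c).complete, one_apply_eq_self]

lemma isShift_iff (A : H c →L[ℂ] H c) :
    IsShift c A ↔ ∀ x, A (symbolMap c x) = symbolMap c (symbolShift d K x) := by
  constructor
  · intro h x
    induction x using Finsupp.induction_linear with
    | zero => simp
    | add x y hx hy => simp only [map_add, hx, hy]
    | single p v => rw [symbolMap_single, symbolMap_symbolShift_single, h]
  · intro h j α v
    rw [← symbolMap_symbolShift_single, ← h, symbolMap_single]

lemma denseRange_symbolMap : DenseRange (symbolMap c) := by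
  refine Submodule.dense_iff_topologicalClosure_eq_top (s := (symbolMap c).range).mpr ?_
  rw [Submodule.topologicalClosure_eq_top_iff, Submodule.eq_bot_iff]
  intro x hx
  ext1 j
  have hj : x j ∈ (Submodule.span ℂ {y | ∃ α v, symi c j α v = y})ᗮ := by
    rw [Submodule.mem_orthogonal]
    intro u hu
    induction hu using Submodule.span_induction with
    | mem u hu =>
      obtain ⟨α, v, rfl⟩ := hu
      have horth := (Submodule.mem_orthogonal _ _).mp hx _ ⟨Finsupp.single (j, α) v, rfl⟩
      rwa [symbolMap_single, inner_P_left, sym_apply] at horth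
    | zero => simp
    | add u w _ _ hu hw => rw [inner_add_left, hu, hw, add_zero]
    | smul a u _ hu => rw [inner_smul_left, hu, mul_zero]
  rw [Submodule.topologicalClosure_eq_top_iff.mp (dense_span_symi c j)] at hj
  exact hj

lemma inner_symbolShift (x y : SymbolSpace d K) :
    inner ℂ (symbolMap c (symbolShift d K x)) (symbolMap c y) =
      inner ℂ (symbolMap c x) (symbolMap c (symbolShift d K y)) := by
  induction x using Finsupp.induction_linear with
  | zero => simp
  | add x x' hx hx' => simp only [map_add, inner_add_left, hx, hx']
  | single p w =>
    induction y using Finsupp.induction_linear with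
    | zero => simp
    | add y y' hy hy' => simp only [map_add, inner_add_right, hy, hy']
    | single q v =>
      obtain ⟨j, β⟩ := p
      obtain ⟨k, α⟩ := q
      simp only [symbolMap_symbolShift_single, symbolMap_single, inner_P_sym, inner_sym_P,
        FreeMonoid.reverse_mul, FreeMonoid.reverse_of, mul_assoc]

lemma norm_inner_symbolShift_pow_single_le (j k : Fin d) (α β : Word d) (v w : K) (m : ℕ) :
    ‖inner ℂ (symbolMap c (Finsupp.single (j, β) w))
      (symbolMap c ((symbolShift d K ^ m) (Finsupp.single (k, α) v)))‖ ≤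
      ‖w‖ * ‖v‖ * ∑ u : Fin m → Fin d,
        ‖c (β.reverse * FreeMonoid.of j * FreeMonoid.ofList (List.ofFn u) * α)‖ := by
  induction m generalizing j β with
  | zero =>
    rw [pow_zero, Module.End.one_apply, symbolMap_single, symbolMap_single, inner_P_left, P_apply]
    split_ifs with hjk
    · rw [sym_apply, sym_apply, inner_symi, Fintype.sum_unique, List.ofFn_zero,
        FreeMonoid.ofList_nil, mul_one, mul_assoc ‖w‖, mul_comm ‖v‖]
      exact (norm_inner_le_norm _ _).trans (by gcongr; exact ContinuousLinearMap.le_opNorm _ _)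
    · rw [inner_zero_right, norm_zero]
      positivity
  | succ m ih =>
    rw [pow_succ', Module.End.mul_apply, ← inner_symbolShift, symbolShift_single, map_sum,
      sum_inner, sum_ofFn_succ (fun γ => ‖c (β.reverse * FreeMonoid.of j * γ * α)‖),
      Finset.mul_sum]
    refine norm_sum_le_of_le _ fun i _ => (ih i _).trans_eq ?_
    simp only [FreeMonoid.reverse_mul, FreeMonoid.reverse_of, mul_assoc]

variable {c} {r : ℝ}

lemma isBigO_inner_symbolShift_pow (hr : 0 < r) (hc : Summable fun α => ‖c α‖ * r ^ α.length)
    (x y : SymbolSpace d K) :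
    (fun m => inner ℂ (symbolMap c x) (symbolMap c ((symbolShift d K ^ m) y)))
      =O[atTop] (r⁻¹ ^ ·) := by
  induction x using Finsupp.induction_linear with
  | zero => simpa only [map_zero, inner_zero_left] using isBigO_zero _ _
  | add x x' hx hx' => simpa only [map_add, inner_add_left] using hx.add hx'
  | single p w =>
    induction y using Finsupp.induction_linear with
    | zero => simpa only [map_zero, inner_zero_right] using isBigO_zero _ _
    | add y y' hy hy' => simpa only [map_add, inner_add_right] using hy.add hy'
    | single q v =>
      refine (IsBigO.of_norm_le fun m => ?_).trans
        ((isBigO_sum_norm_coeff hr hc (p.2.reverse * FreeMonoid.of p.1) q.2).const_mul_left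
          (‖w‖ * ‖v‖))
      exact norm_inner_symbolShift_pow_single_le c p.1 q.1 q.2 p.2 v w m

lemma norm_symbolMap_symbolShift_le (hr : 0 < r)
    (hc : Summable fun α => ‖c α‖ * r ^ α.length) (x : SymbolSpace d K) :
    ‖symbolMap c (symbolShift d K x)‖ ≤ r⁻¹ * ‖symbolMap c x‖ :=
  norm_apply_le_of_isBigO_moments (inner_symbolShift c) (inv_nonneg.mpr hr.le)
    (isBigO_inner_symbolShift_pow hr hc x x)

lemma exists_isShift (hr : 0 < r) (hc : Summable fun α => ‖c α‖ * r ^ α.length) :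
    ∃ A : H c →L[ℂ] H c, IsShift c A :=
  ⟨(symbolMap c ∘ₗ symbolShift d K).extendOfNorm (symbolMap c), (isShift_iff c _).mpr <|
    LinearMap.extendOfNorm_eq (denseRange_symbolMap c) ⟨r⁻¹, norm_symbolMap_symbolShift_le hr hc⟩⟩

variable {A : H c →L[ℂ] H c}

lemma IsShift.unique {A' : H c →L[ℂ] H c} (hA : IsShift c A) (hA' : IsShift c A') : A = A' := by
  rw [isShift_iff] at hA hA'
  exact DFunLike.coe_injective <| (denseRange_symbolMap c).equalizer A.continuous A'.continuous <|
    funext fun x => (hA x).trans (hA' x).symm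

lemma IsShift.isSelfAdjoint (hA : IsShift c A) : IsSelfAdjoint A := by
  rw [isShift_iff] at hA
  refine ContinuousLinearMap.isSelfAdjoint_iff_isSymmetric.mpr fun x y => ?_
  refine (denseRange_symbolMap c).induction_on₂
    (p := fun x y => inner ℂ (A x) y = inner ℂ x (A y))
    (isClosed_eq (by fun_prop) (by fun_prop)) (fun x y => ?_) x y
  rw [hA, hA, inner_symbolShift]

lemma IsShift.norm_le (hA : IsShift c A) (hr : 0 < r)
    (hc : Summable fun α => ‖c α‖ * r ^ α.length) : ‖A‖ ≤ r⁻¹ := by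
  rw [isShift_iff] at hA
  refine ContinuousLinearMap.opNorm_le_bound _ (by positivity) fun x => ?_
  refine (denseRange_symbolMap c).induction_on (p := fun x => ‖A x‖ ≤ r⁻¹ * ‖x‖) x
    (isClosed_le (by fun_prop) (by fun_prop)) fun x => ?_
  rw [hA]
  exact norm_symbolMap_symbolShift_le hr hc x

lemma IsShift.norm_le_of_hasPointwiseSeriesOn (hA : IsShift c A)
    {f : ∀ n, Tuple d n → (Amp n K →L[ℂ] Amp n K)} {R : ℝ} (hR : 0 < R)
    (hseries : HasPointwiseSeriesOn c f R) : ‖A‖ ≤ R⁻¹ := by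
  refine le_of_forall_gt_imp_ge_of_dense fun a ha => ?_
  have ha₀ : 0 < a⁻¹ := inv_pos.mpr ((inv_pos.mpr hR).trans ha)
  simpa only [inv_inv] using
    hA.norm_le ha₀ (hseries.summable_norm_coeff ha₀.le (inv_lt_of_inv_lt₀ hR ha))

lemma IsShift.apply_sym (hA : IsShift c A) (α : Word d) (v : K) :
    A (sym c α v) = ∑ i, sym c (FreeMonoid.of i * α) v := by
  have hsum : sym c α v = ∑ i, P c i (sym c α v) := by
    rw [← sum_apply, (completeOrthogonalIdempotents_P c).complete, one_apply_eq_self]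
  rw [hsum, map_sum]
  exact Finset.sum_congr rfl fun i _ => hA i α v

end Shift

section NeumannSeries

variable {B : Type*} [NormedRing B] [HasSummableGeomSeries B] {a : B} {u : Bˣ}

lemma sub_inv_eq_neg_oneSub_mul_inv (h : ‖a * u‖ < 1) :
    a - ↑u⁻¹ = ↑(-(Units.oneSub (a * u) h * u⁻¹)) := by
  simp [sub_mul]

lemma isUnit_sub_inv_of_norm_mul_lt_one (h : ‖a * u‖ < 1) : IsUnit (a - ↑u⁻¹) :=
  sub_inv_eq_neg_oneSub_mul_inv h ▸ Units.isUnit _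

lemma hasSum_neg_inverse_sub_inv (h : ‖a * u‖ < 1) :
    HasSum (fun k : ℕ => u * (a * u) ^ k) (-Ring.inverse (a - ↑u⁻¹)) := by
  have hinv : -Ring.inverse (a - ↑u⁻¹) = u * ∑' k, (a * u) ^ k := by
    rw [sub_inv_eq_neg_oneSub_mul_inv h, Ring.inverse_unit, inv_neg, Units.val_neg, neg_neg,
      mul_inv_rev, inv_inv, Units.val_mul]
    rfl
  rw [hinv]
  exact (summable_geometric_of_norm_lt_one h).hasSum.mul_left _

end NeumannSeries

lemma hasSum_comp_comp {𝕜 E F G V : Type*} [NontriviallyNormedField 𝕜]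
    [NormedAddCommGroup E] [NormedSpace 𝕜 E] [NormedAddCommGroup F] [NormedSpace 𝕜 F]
    [NormedAddCommGroup G] [NormedSpace 𝕜 G] [NormedAddCommGroup V] [NormedSpace 𝕜 V]
    {ι : Type*} {T : ι → (F →L[𝕜] G)} {t : F →L[𝕜] G} (hT : HasSum T t) (S : G →L[𝕜] V)
    (U : E →L[𝕜] F) : HasSum (fun k => S ∘L T k ∘L U) (S ∘L t ∘L U) :=
  hT.mapL (ContinuousLinearMap.compL 𝕜 E G V S ∘L (ContinuousLinearMap.compL 𝕜 E F G).flip U)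

section Realization

variable {d n : ℕ} {K : Type*} [NormedAddCommGroup K] [InnerProductSpace ℂ K] [CompleteSpace K]
  {c : Word d → (K →L[ℂ] K)} [∀ i, Fact (localizingMatrix c i).PosSemidef]
  {A : H c →L[ℂ] H c}

variable (c) in
/-- The block diagonal operator `∑ P_i Z_i` on `H ⊗ ℂⁿ`, as a star homomorphism in the tuple `Z`. -/
def blockDiag (n : ℕ) : Tuple d n →⋆ₐ[ℂ] (Amp n (H c) →L[ℂ] Amp n (H c)) :=
  projTensorHom n (completeOrthogonalIdempotents_P c) (isSelfAdjoint_P c)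

lemma blockDiag_apply (Z : Tuple d n) : blockDiag c n Z = ∑ i, tensor (P c i) (Z i) := rfl

lemma norm_blockDiag_le (Z : Tuple d n) : ‖blockDiag c n Z‖ ≤ ‖Z‖ :=
  NonUnitalStarAlgHom.norm_apply_le (blockDiag c n) Z

lemma pencil_eq (A : H c →L[ℂ] H c) (U : (Tuple d n)ˣ) :
    pencil c A (U : Tuple d n) = tensor A 1 - blockDiag c n ↑U⁻¹ := by
  have hinv (i : Fin d) : (↑U⁻¹ : Tuple d n) i = ((U : Tuple d n) i)⁻¹ :=
    (Matrix.inv_eq_right_inv (congr_fun U.mul_inv i)).symm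
  simp only [pencil, blockDiag_apply, hinv]

lemma blockDiag_comp_tensor (Z : Tuple d n) {E : Type*} [NormedAddCommGroup E]
    [InnerProductSpace ℂ E] (T : E →L[ℂ] H c) (M : Matrix (Fin n) (Fin n) ℂ) :
    blockDiag c n Z ∘L tensor T M = ∑ i, tensor (P c i ∘L T) (Z i * M) := by
  simp only [tensor_comp, blockDiag_apply, ContinuousLinearMap.finsetSum_comp]

lemma adjoint_Q_comp_P_comp_sym (i : Fin d) (α : Word d) :
    (Q c).adjoint ∘L P c i ∘L sym c α = c (FreeMonoid.of i * α) := by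
  ext v
  refine ext_inner_left ℂ fun w => ?_
  rw [ContinuousLinearMap.comp_apply, ContinuousLinearMap.adjoint_inner_right,
    ContinuousLinearMap.comp_apply, Q, inner_sym_P]
  rfl

lemma IsShift.tensor_comp_blockDiag_comp_tensor_sym (hA : IsShift c A) (Z : Tuple d n)
    (α : Word d) :
    tensor A 1 ∘L blockDiag c n Z ∘L tensor (sym c α) (FreeMonoid.lift Z α) =
      ∑ i, tensor (sym c (FreeMonoid.of i * α)) (FreeMonoid.lift Z (FreeMonoid.of i * α)) := by
  rw [blockDiag_comp_tensor, ContinuousLinearMap.comp_finsetSum]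
  refine Finset.sum_congr rfl fun i _ => ?_
  have hAP : A ∘L P c i ∘L sym c α = sym c (FreeMonoid.of i * α) :=
    ContinuousLinearMap.ext fun v => hA i α v
  rw [← tensor_comp, hAP, one_mul, map_mul, FreeMonoid.lift_eval_of]

lemma IsShift.pow_comp_tensor_Q (hA : IsShift c A) (Z : Tuple d n) (k : ℕ) :
    ((tensor A 1 * blockDiag c n Z) ^ k) ∘L tensor (Q c) 1 =
      ∑ w : Fin k → Fin d, tensor (sym c (FreeMonoid.ofList (List.ofFn w)))
        (FreeMonoid.lift Z (FreeMonoid.ofList (List.ofFn w))) := by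
  induction k with
  | zero =>
    rw [pow_zero, Fintype.sum_unique, List.ofFn_zero, FreeMonoid.ofList_nil, map_one]
    rfl
  | succ k ih =>
    rw [pow_succ', ContinuousLinearMap.mul_def, ContinuousLinearMap.comp_assoc, ih,
      ContinuousLinearMap.comp_finsetSum,
      sum_ofFn_succ fun α => tensor (sym c α) (FreeMonoid.lift Z α), Finset.sum_comm]
    exact Finset.sum_congr rfl fun w _ => hA.tensor_comp_blockDiag_comp_tensor_sym Z _

lemma IsShift.adjoint_Q_comp_pow (hA : IsShift c A) (Z : Tuple d n) (k : ℕ) :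
    (tensor (Q c) 1).adjoint ∘L (blockDiag c n Z * (tensor A 1 * blockDiag c n Z) ^ k) ∘L
      tensor (Q c) 1 = ∑ w : Fin (k + 1) → Fin d,
        seriesTerm c Z (FreeMonoid.ofList (List.ofFn w)) := by
  rw [ContinuousLinearMap.mul_def, ContinuousLinearMap.comp_assoc, hA.pow_comp_tensor_Q,
    ContinuousLinearMap.comp_finsetSum, ContinuousLinearMap.comp_finsetSum, sum_ofFn_succ,
    Finset.sum_comm]
  refine Finset.sum_congr rfl fun w _ => ?_
  rw [blockDiag_comp_tensor, ContinuousLinearMap.comp_finsetSum]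
  refine Finset.sum_congr rfl fun i _ => ?_
  rw [adjoint_tensor, Matrix.conjTranspose_one, ← tensor_comp, adjoint_Q_comp_P_comp_sym, one_mul,
    seriesTerm, map_mul, FreeMonoid.lift_eval_of]

lemma IsShift.norm_tensor_mul_blockDiag_lt_one (hA : IsShift c A)
    {f : ∀ n, Tuple d n → (Amp n K →L[ℂ] Amp n K)} {R : ℝ} (hR : 0 < R)
    (hseries : HasPointwiseSeriesOn c f R) {Z : Tuple d n} (hZ : Z ∈ complexBall d R n) :
    ‖tensor A 1 * blockDiag c n Z‖ < 1 :=
  calc ‖tensor A 1 * blockDiag c n Z‖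
      ≤ ‖tensor A (1 : Matrix (Fin n) (Fin n) ℂ)‖ * ‖blockDiag c n Z‖ := norm_mul_le _ _
    _ ≤ R⁻¹ * ‖Z‖ := by
        gcongr
        · exact (norm_tensor_one_right_le A).trans (hA.norm_le_of_hasPointwiseSeriesOn hR hseries)
        · exact norm_blockDiag_le Z
    _ < 1 := by
        rw [inv_mul_lt_iff₀ hR, mul_one]
        exact (mem_complexBall_iff_norm_lt hR).mp hZ

lemma IsShift.realization (hA : IsShift c A) {f : ∀ n, Tuple d n → (Amp n K →L[ℂ] Amp n K)} {R : ℝ}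
    (hR : 0 < R) (hseries : HasPointwiseSeriesOn c f R) {Z : Tuple d n}
    (hZ : Z ∈ complexBall d R n) (hunit : ∀ i, IsUnit (Z i)) :
    IsUnit (pencil c A Z) ∧
      f n Z = tensor (c 1) 1 - (tensor (Q c) 1).adjoint ∘L
        Ring.inverse (pencil c A Z) ∘L tensor (Q c) 1 := by
  obtain ⟨U, rfl⟩ : IsUnit Z := Pi.isUnit_iff.mpr hunit
  have hlt := hA.norm_tensor_mul_blockDiag_lt_one hR hseries hZ
  let D : (Amp n (H c) →L[ℂ] Amp n (H c))ˣ :=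
    Units.map (blockDiag c n : Tuple d n →* (Amp n (H c) →L[ℂ] Amp n (H c))) U
  have hpencil : pencil c A ↑U = tensor A 1 - (↑D⁻¹ : Amp n (H c) →L[ℂ] Amp n (H c)) :=
    pencil_eq A U
  rw [hpencil]
  refine ⟨isUnit_sub_inv_of_norm_mul_lt_one (u := D) hlt, ?_⟩
  have hneumann := hasSum_comp_comp (hasSum_neg_inverse_sub_inv (u := D) hlt)
    (tensor (Q c) 1).adjoint (tensor (Q c) 1)
  have htail := (hasSum_nat_add_iff' 1).mpr (hasSum_sum_ofFn (hseries.hasSum n _ hZ))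
  simp only [← hA.adjoint_Q_comp_pow] at htail
  have hf := htail.unique hneumann
  rw [Finset.sum_range_one, Fintype.sum_unique, List.ofFn_zero, FreeMonoid.ofList_nil, seriesTerm,
    map_one, ContinuousLinearMap.neg_comp, ContinuousLinearMap.comp_neg] at hf
  rw [sub_eq_add_neg, ← hf, add_sub_cancel]

end Realization

end NCRealization

end

theorem mainTheorem6_general {d : ℕ} {K : Type*} [NormedAddCommGroup K] [InnerProductSpace ℂ K]
    [CompleteSpace K] {R ρ : ℝ} (hR : 0 < R) (hρ : 0 < ρ)
    {c : NCRealization.Word d → (K →L[ℂ] K)}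
    {f : ∀ n : ℕ, NCRealization.Tuple d n →
      (NCRealization.Amp n K →L[ℂ] NCRealization.Amp n K)}
    (hmono : NCRealization.LoewnerMonotoneOn (NCRealization.realBall d ρ) f)
    (hseries : NCRealization.HasPointwiseSeriesOn c f R) :
    ∃ _ : ∀ i : Fin d, Fact (NCRealization.localizingMatrix c i).PosSemidef,
      (∃! A : NCRealization.H c →L[ℂ] NCRealization.H c, NCRealization.IsShift c A) ∧
      ∀ A : NCRealization.H c →L[ℂ] NCRealization.H c, NCRealization.IsShift c A →
        (∀ (α : NCRealization.Word d) (v : K), A (NCRealization.sym c α v) =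
          ∑ i, NCRealization.sym c (FreeMonoid.of i * α) v) ∧
        IsSelfAdjoint A ∧ ‖A‖ ≤ R⁻¹ ∧
        ∀ n : ℕ, ∀ Z ∈ NCRealization.complexBall d R n, (∀ i, IsUnit (Z i)) →
          IsUnit (NCRealization.pencil c A Z) ∧
          f n Z = NCRealization.tensor (c 1) 1 -
            (NCRealization.tensor (NCRealization.Q c) 1).adjoint ∘L
              Ring.inverse (NCRealization.pencil c A Z) ∘L
              NCRealization.tensor (NCRealization.Q c) 1 := by
  have hpos (i : Fin d) : Fact (NCRealization.localizingMatrix c i).PosSemidef :=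
    ⟨NCRealization.posSemidef_localizingMatrix hρ hmono hR hseries i⟩
  obtain ⟨A₀, hA₀⟩ := NCRealization.exists_isShift (half_pos hR)
    (hseries.summable_norm_coeff (half_pos hR).le (half_lt_self hR))
  exact ⟨hpos, ⟨A₀, hA₀, fun A hA => hA.unique hA₀⟩, fun A hA =>
    ⟨hA.apply_sym, hA.isSelfAdjoint, hA.norm_le_of_hasPointwiseSeriesOn hR hseries,
      fun n Z hZ hunit => hA.realization hR hseries hZ hunit⟩⟩

theorem mainTheorem6 {d : ℕ} {K : Type*} [NormedAddCommGroup K] [InnerProductSpace ℂ K]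
    [CompleteSpace K] (ε : ℝ) (hε : 0 < ε)
    (c : NCRealization.Word d → (K →L[ℂ] K))
    (f : ∀ n : ℕ, NCRealization.Tuple d n →
      (NCRealization.Amp n K →L[ℂ] NCRealization.Amp n K))
    (hmono : NCRealization.MatrixMonotoneOn (NCRealization.realBall d (1 + ε)) f)
    (hseries : NCRealization.HasPowerSeriesOnComplexBall c f (1 + ε)) :
    ∃ _ : ∀ i : Fin d, Fact (NCRealization.localizingMatrix c i).PosSemidef,
      (∃! A : NCRealization.H c →L[ℂ] NCRealization.H c, NCRealization.IsShift c A) ∧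
      ∀ A : NCRealization.H c →L[ℂ] NCRealization.H c, NCRealization.IsShift c A →
        (∀ (α : NCRealization.Word d) (v : K), A (NCRealization.sym c α v) =
          ∑ i, NCRealization.sym c (FreeMonoid.of i * α) v) ∧
        IsSelfAdjoint A ∧ ‖A‖ ≤ 1 ∧
        ∀ n : ℕ, ∀ Z ∈ NCRealization.complexBall d (1 + ε) n, (∀ i, IsUnit (Z i)) →
          IsUnit (NCRealization.pencil c A Z) ∧
          f n Z = NCRealization.tensor (c 1) 1 -
            (NCRealization.tensor (NCRealization.Q c) 1).adjoint ∘L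
              Ring.inverse (NCRealization.pencil c A Z) ∘L
              NCRealization.tensor (NCRealization.Q c) 1 := by
  have hR : 0 < 1 + ε := by positivity
  obtain ⟨hpos, hshift, h⟩ := mainTheorem6_general hR hR hmono.2 hseries.hasPointwiseSeriesOn
  refine ⟨hpos, hshift, fun A hA => ?_⟩
  obtain ⟨hsym, hsa, hnorm, hrealization⟩ := h A hA
  exact ⟨hsym, hsa, hnorm.trans (inv_le_one_of_one_le₀ (by linarith)), hrealization⟩
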